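/- For integers $d\ge 1$, let $\mathcal P_d^+$ be the set of positive signals $F=(\mathbf a,\mathbf x)$ with amplitudes $\mathbf a=(a_1,\dots,a_d)$, $a_j>0$, and real nodes $\mathbf x=(x_1,\dots,x_d)$, $x_1<\dots<x_d$; such an $F$ is identified with the measure $\sum_{j=1}^d a_j\delta_{x_j}$, and $\mathcal F[F](s)=\sum_{j=1}^d a_j e^{-2\pi i x_j s}$. For $\epsilon,\Omega>0$ let $$E^+_{\epsilon,\Omega}(F)=\{\hat F\in\mathcal P_d^+:\ |\mathcal F[\hat F](s)-\mathcal F[F](s)|\le\epsilon\ \text{ for all } s\in[-\Omega,\Omega]\},$$ and let $E^{+,\mathbf x,j}_{\epsilon,\Omega}(F)\subset\mathbb R$ and $E^{+,\mathbf a,j}_{\epsilon,\Omega}(F)\subset\mathbb R$ be the sets of the $j$-th nodes and of the $j$-th amplitudes, respectively, of the signals in $E^+_{\epsilon,\Omega}(F)$. Diameters are suprema of distances in $[0,\infty]$. For $p\ge 2$, $0<\tau,\eta\le 1$, $0<h\le T$ and $1\le\kappa\le d-p+1$, a node vector $\mathbf x\in\mathbb R^d$ forms a $(p,h,T,\tau,\eta)$-clustered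 configuration with cluster indices $I_\kappa=\{\kappa,\dots,\kappa+p-1\}$ if $\tau h\le|x_j-x_k|\le h$ for all $j\ne k$ in $I_\kappa$, and $\eta T\le|x_\ell-x_j|\le T$ for all $\ell\notin I_\kappa$ and all $j\neq\ell$. **Theorem.** Let $2\le p\le d$ be integers and $0<m\le M<\infty$. There exist positive constants $C_1',\dots,C_5'$, depending only on $d,p,m,M$, such that the following holds. Let $1\le\kappa\le d-p+1$, $0<\tau\le\frac1{p-1}$, $0<\eta<\frac1d$ and $T>0$. For all $\Omega,h>0$ with $h\le C_4'T$ and $\Omega h\le C_5'$ there exists $F=(\mathbf a,\mathbf x)\in\mathcal P_d^+$, with $\mathbf x$ forming a $(p,h,T,\tau,\eta)$-clustered configuration with cluster indices $I_\kappa$ and with $m\le\|\mathbf a\|_\infty\le M$, and there exist $j_1,j_2\in I_\kappa$, such that for every $0<\epsilon\le C_3'(\Omega\tau h)^{2p-1}$: $$\operatorname{diam}\big(E^{+,\mathbf x,j_1}_{\epsilon,\Omega}(F)\big)\ge\frac{C_1'}{\Omega}\,\epsilon\,(\Omega\tau h)^{-2p+2},\qquad \operatorname{diam}\big(E^{+,\mathbf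 x,j}_{\epsilon,\Omega}(F)\big)\ge\frac{C_1'}{\Omega}\,\epsilon\quad\text{for all } j\notin I_\kappa,$$ $$\operatorname{diam}\big(E^{+,\mathbf a,j_2}_{\epsilon,\Omega}(F)\big)\ge C_2'\,\epsilon\,(\Omega\tau h)^{-2p+1},\qquad \operatorname{diam}\big(E^{+,\mathbf a,j}_{\epsilon,\Omega}(F)\big)\ge C_2'\,\epsilon\quad\text{for all } j\notin I_\kappa.$$ -/

import Mathlib

open MeasureTheory

noncomputable section

/-- A positive signal `F = ∑ j, a j • δ (x j)` with `d` positive amplitudes `a j` and real, distinct,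
increasingly ordered nodes `x j`. -/
structure PosSignal (d : ℕ) where
  /-- the amplitude vector -/
  amp : Fin d → ℝ
  /-- the node vector -/
  node : Fin d → ℝ
  amp_pos : ∀ j, 0 < amp j
  node_strictMono : StrictMono node

namespace PosSignal

variable {d : ℕ}

/-- The discrete measure `∑ j, a j • δ (x j)` on the real line. -/
def toMeasure (F : PosSignal d) : Measure ℝ :=
  ∑ j, ENNReal.ofReal (F.amp j) • Measure.dirac (F.node j)

/-- The Fourier transform `s ↦ ∫ exp (-2 π i s x) dF(x)`, which is
`∑ j, a j * exp (-2 π i s (x j))`. -/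
def fourier (F : PosSignal d) (s : ℝ) : ℂ :=
  ∫ x : ℝ, Complex.exp (-2 * Real.pi * Complex.I * s * x) ∂F.toMeasure

/-- The positive error set of `F`: all positive signals whose Fourier transform is within `ε` of
that of `F` on `[-Ω, Ω]`. -/
def errorSet (ε Ω : ℝ) (F : PosSignal d) : Set (PosSignal d) :=
  {G | ∀ s ∈ Set.Icc (-Ω) Ω, ‖G.fourier s - F.fourier s‖ ≤ ε}

/-- The projection of the positive error set of `F` to the `j`-th node. -/
def nodeErrorSet (ε Ω : ℝ) (F : PosSignal d) (j : Fin d) : Set ℝ :=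
  (fun G : PosSignal d => G.node j) '' errorSet ε Ω F

/-- The projection of the positive error set of `F` to the `j`-th amplitude. -/
def ampErrorSet (ε Ω : ℝ) (F : PosSignal d) (j : Fin d) : Set ℝ :=
  (fun G : PosSignal d => G.amp j) '' errorSet ε Ω F

end PosSignal

/-- The indices of the cluster: the `p` consecutive indices `κ, …, κ + p - 1`
(indices in `Fin d` start at `0`). -/
def clusterIdx (d p κ : ℕ) : Set (Fin d) :=
  {j | κ ≤ (j : ℕ) ∧ (j : ℕ) < κ + p}

/-- The node vector `x` forms a `(p, h, T, τ, η)`-clustered configuration whose cluster consists of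
the `p` nodes with indices `κ, …, κ + p - 1`. -/
structure IsClustered {d : ℕ} (p : ℕ) (h T τ η : ℝ) (κ : ℕ) (x : Fin d → ℝ) : Prop where
  two_le_p : 2 ≤ p
  cluster_le : κ + p ≤ d
  tau_pos : 0 < τ
  tau_le : τ ≤ 1
  eta_pos : 0 < η
  eta_le : η ≤ 1
  h_pos : 0 < h
  h_le : h ≤ T
  cluster : ∀ j ∈ clusterIdx d p κ, ∀ k ∈ clusterIdx d p κ, j ≠ k →
    τ * h ≤ |x j - x k| ∧ |x j - x k| ≤ h
  nonCluster : ∀ l ∉ clusterIdx d p κ, ∀ j, l ≠ j →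
    η * T ≤ |x l - x j| ∧ |x l - x j| ≤ T

end

/-! A positive cluster is hard to resolve because a divided difference of order 2p - 1 at 2p
interlacing points has weights of alternating sign, so it is a difference of two positive measures
with p atoms each. Applied to exp(iω·) it has size O(|ω|^(2p-1)), so on [-Ω, Ω] two such clusters at
scale Δ = τh are nearly indistinguishable.

One of the two measures must not depend on ε. Let P = X(X-1)⋯(X-p+1) and Q = P - tP', and take the
roots of PQ as points. The weight 1/(PQ)' equals -1/(t P'(k)²) at a root k of P. At a root of Q,
where P = tP', it equals 1/(t(P'² - PP'')), which is positive by Laguerre's inequality. After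
multiplication by t the negative part has the fixed atoms k and amplitudes 1/P'(k)²; this is the
cluster of F. The positive part is the competitor, and t is the free parameter.

The transforms differ by O(t(ΩΔ)^(2p-1)), so t is of order ε(ΩΔ)^(-2p+1). The last root of Q lies at
least t beyond that of P, and the last amplitude drops by a multiple of t. Hence the node error is
at least Δt and the amplitude error is of order t. Nodes outside the cluster are perturbed one at a
time.

The main steps are `norm_sum_nodalWeight_mul_exp_le`, `exists_interlacing_roots`,
`sq_eval_nodal_erase_le` and `norm_sum_sub_sum_exp_le`, combined in `exists_cluster_perturbation`.
-/

noncomputable section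

/-! ### Divided differences of exponentials. -/

/-- Generalized Rolle theorem. -/
theorem exists_iteratedDeriv_eq_zero_of_card {n : ℕ} {f : ℝ → ℝ} (hf : ContDiff ℝ n f)
    {S : Finset ℝ} (hS : S.card = n + 1) (h0 : ∀ x ∈ S, f x = 0) :
    ∃ ξ, iteratedDeriv n f ξ = 0 := by
  induction n generalizing f S with
  | zero =>
    obtain ⟨x, hx⟩ := Finset.card_pos.1 (by omega : 0 < S.card)
    exact ⟨x, by simpa using h0 x hx⟩
  | succ n ih =>
    set x := S.orderEmbOfFin hS with hx
    have hmem : ∀ i, f (x i) = 0 := fun i => h0 _ (S.orderEmbOfFin_mem hS i)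
    have hroot : ∀ i : Fin (n + 1), ∃ c ∈ Set.Ioo (x i.castSucc) (x i.succ), deriv f c = 0 :=
      fun i => exists_deriv_eq_zero (x.strictMono i.castSucc_lt_succ)
        hf.continuous.continuousOn ((hmem _).trans (hmem _).symm)
    choose c hc hc0 using hroot
    have hmono : StrictMono c := by
      intro i j hij
      refine (hc i).2.trans_le (le_trans ?_ (hc j).1.le)
      exact x.monotone (Fin.succ_le_castSucc_iff.2 hij)
    have hcd : ContDiff ℝ n (deriv f) := by
      have : ContDiff ℝ ((n : WithTop ℕ∞) + 1) f := by exact_mod_cast hf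
      exact (contDiff_succ_iff_deriv.1 this).2.2
    obtain ⟨ξ, hξ⟩ := ih hcd (S := Finset.univ.map ⟨c, hmono.injective⟩) (by simp)
      (by simpa using hc0)
    exact ⟨ξ, by rw [iteratedDeriv_succ']; exact hξ⟩

theorem Polynomial.iteratedDeriv_eval (q : Polynomial ℝ) (n : ℕ) :
    iteratedDeriv n (fun x => q.eval x) = fun x => (Polynomial.derivative^[n] q).eval x := by
  induction n generalizing q with
  | zero => simp
  | succ n ih =>
    rw [iteratedDeriv_succ']
    have : deriv (fun x => q.eval x) = fun x => (Polynomial.derivative q).eval x := by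
      funext x
      exact q.deriv
    rw [this, ih, Function.iterate_succ_apply]

/-- Mean value theorem for divided differences. -/
theorem exists_sum_nodalWeight_mul_eq_iteratedDeriv {n : ℕ} {f : ℝ → ℝ} (hf : ContDiff ℝ n f)
    {s : Finset ℕ} {y : ℕ → ℝ} (hy : Set.InjOn y s) (hs : s.card = n + 1) :
    ∃ ξ, n.factorial * ∑ i ∈ s, Lagrange.nodalWeight s y i * f (y i) = iteratedDeriv n f ξ := by
  classical
  set q := Lagrange.interpolate s y (fun i => f (y i)) with hq
  have hqd : ContDiff ℝ n (fun x => q.eval x) := by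
    simpa [Polynomial.aeval_def] using q.contDiff_aeval (R := ℝ) (𝕜 := ℝ) n
  obtain ⟨ξ, hξ⟩ := exists_iteratedDeriv_eq_zero_of_card (n := n) (f := fun x => f x - q.eval x)
    (hf.sub hqd) (S := s.image y) (by rw [Finset.card_image_of_injOn hy, hs]) (by
      intro x hx
      obtain ⟨i, hi, rfl⟩ := Finset.mem_image.1 hx
      rw [hq, Lagrange.eval_interpolate_at_node _ hy hi, sub_self])
  refine ⟨ξ, ?_⟩
  rw [iteratedDeriv_fun_sub hf.contDiffAt hqd.contDiffAt, sub_eq_zero] at hξ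
  -- The interpolant has degree at most n, so its n-th derivative is the constant n! times its top
  -- coefficient, which is the divided difference.
  rw [hξ, Polynomial.iteratedDeriv_eval, hq, Lagrange.iterate_derivative_interpolate _ hy (by omega)]
  simp [Polynomial.eval_finsetSum, hs, Lagrange.nodalWeight, div_eq_mul_inv, mul_comm]

/-- The mean value theorem is real, so it is applied to cosine and sine separately; this costs the
factor 2. The gain of 1/n! is discarded. -/
theorem norm_sum_nodalWeight_mul_exp_le {n : ℕ} {s : Finset ℕ} {y : ℕ → ℝ} (hy : Set.InjOn y s)
    (hs : s.card = n + 1) (ω : ℝ) :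
    ‖∑ i ∈ s, ((Lagrange.nodalWeight s y i : ℝ) : ℂ) * Complex.exp ((ω * y i : ℝ) * Complex.I)‖ ≤
      2 * |ω| ^ n := by
  have key : ∀ g : ℝ → ℝ, ContDiff ℝ n g → (∀ x, |iteratedDeriv n g x| ≤ 1) →
      |∑ i ∈ s, Lagrange.nodalWeight s y i * g (ω * y i)| ≤ |ω| ^ n := by
    intro g hg hb
    obtain ⟨ξ, hξ⟩ := exists_sum_nodalWeight_mul_eq_iteratedDeriv (n := n)
      (f := fun x => g (ω * x)) (by fun_prop) hy hs
    simp only [iteratedDeriv_comp_const_mul hg] at hξ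
    have h1 : (1 : ℝ) ≤ n.factorial := by exact_mod_cast n.factorial_pos
    calc |∑ i ∈ s, Lagrange.nodalWeight s y i * g (ω * y i)|
        ≤ n.factorial * |∑ i ∈ s, Lagrange.nodalWeight s y i * g (ω * y i)| :=
          le_mul_of_one_le_left (abs_nonneg _) h1
      _ = |ω ^ n * iteratedDeriv n g (ω * ξ)| := by
          rw [← hξ, abs_mul, abs_of_nonneg (by positivity : (0 : ℝ) ≤ n.factorial)]
      _ ≤ |ω| ^ n := by
          rw [abs_mul, abs_pow]
          exact mul_le_of_le_one_right (by positivity) (hb _)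
  refine (Complex.norm_le_abs_re_add_abs_im _).trans ?_
  have hre := key Real.cos Real.contDiff_cos (Real.abs_iteratedDeriv_cos_le_one n)
  have him := key Real.sin Real.contDiff_sin (Real.abs_iteratedDeriv_sin_le_one n)
  rw [Complex.re_sum, Complex.im_sum]
  simp only [Complex.re_ofReal_mul, Complex.im_ofReal_mul, Complex.exp_ofReal_mul_I_re,
    Complex.exp_ofReal_mul_I_im]
  linarith

/-! ### Laguerre's inequality. -/

open Polynomial Lagrange Finset

/-- With L(f) = f'² - f f'', one has L((X - a)N) = N² + (x - a)² L(N), which drives the induction.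
Keeping the term N² gives the sharper form below. -/
theorem laguerre_nodal_nonneg (s : Finset ℕ) (v : ℕ → ℝ) (x : ℝ) :
    0 ≤ (derivative (nodal s v)).eval x ^ 2 -
      (nodal s v).eval x * (derivative (derivative (nodal s v))).eval x := by
  induction s using Finset.induction_on with
  | empty => simp
  | insert a s ha ih =>
    rw [nodal_insert_eq_nodal ha]
    simp only [derivative_mul, derivative_sub, derivative_X, derivative_C, eval_add, eval_mul,
      eval_sub, eval_X, eval_C, derivative_add, sub_zero, one_mul]
    nlinarith [mul_nonneg (sq_nonneg (x - v a)) ih, sq_nonneg ((nodal s v).eval x)]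

/-- Laguerre's inequality for a polynomial with real roots, with one term of the gap. -/
theorem sq_eval_nodal_erase_le (s : Finset ℕ) (v : ℕ → ℝ) (x : ℝ) {k : ℕ} (hk : k ∈ s) :
    (nodal (s.erase k) v).eval x ^ 2 ≤ (derivative (nodal s v)).eval x ^ 2 -
      (nodal s v).eval x * (derivative (derivative (nodal s v))).eval x := by
  have ih := laguerre_nodal_nonneg (s.erase k) v x
  rw [nodal_eq_mul_nodal_erase hk]
  simp only [derivative_mul, derivative_sub, derivative_X, derivative_C, eval_add, eval_mul,
    eval_sub, eval_X, eval_C, derivative_add, sub_zero, one_mul]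
  nlinarith [mul_nonneg (sq_nonneg (x - v k)) ih]

/-! ### The grid polynomial P and the roots of P - tP'. -/

/-- The monic polynomial with roots `0, …, p - 1`. -/
def gridPoly (p : ℕ) : Polynomial ℝ :=
  Lagrange.nodal (Finset.range p) (fun i => (i : ℝ))


theorem eval_derivative_gridPoly_natCast {p k : ℕ} (hk : k < p) :
    (derivative (gridPoly p)).eval (k : ℝ) = ∏ i ∈ (range p).erase k, ((k : ℝ) - i) := by
  rw [gridPoly, eval_nodal_derivative_eval_node_eq (v := fun i : ℕ => (i : ℝ)) (mem_range.2 hk),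
    eval_nodal]

theorem eval_derivative_gridPoly_natCast_ne_zero {p k : ℕ} (hk : k < p) :
    (derivative (gridPoly p)).eval (k : ℝ) ≠ 0 := by
  rw [eval_derivative_gridPoly_natCast hk, prod_ne_zero_iff]
  intro i hi
  have := (mem_erase.1 hi).1
  rw [sub_ne_zero]
  exact_mod_cast this.symm

theorem eval_gridPoly_natCast {p k : ℕ} (hk : k < p) : (gridPoly p).eval (k : ℝ) = 0 :=
  eval_nodal_at_node (v := fun i : ℕ => (i : ℝ)) (mem_range.2 hk)

/-- P' alternates in sign at consecutive simple roots. Hence so does P - tP', which equals -tP'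
there, and this gives a root in each gap. -/
theorem eval_derivative_gridPoly_mul_succ_neg {p k : ℕ} (hk : k + 1 < p) :
    (derivative (gridPoly p)).eval (k : ℝ) * (derivative (gridPoly p)).eval ((k + 1 : ℕ) : ℝ)
      < 0 := by
  rw [eval_derivative_gridPoly_natCast (by omega : k < p), eval_derivative_gridPoly_natCast hk,
    ← mul_prod_erase ((range p).erase k) _ (a := k + 1) (by simp [hk]),
    ← mul_prod_erase ((range p).erase (k + 1)) _ (a := k) (by simp; omega),
    erase_right_comm (a := k) (b := k + 1), mul_mul_mul_comm, ← prod_mul_distrib]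
  refine mul_neg_of_neg_of_pos (by push_cast; ring_nf; norm_num) (prod_pos fun i hi => ?_)
  simp only [mem_erase, mem_range] at hi
  rcases lt_or_ge i k with h | h
  · have : (i : ℝ) < k := by exact_mod_cast h
    push_cast
    exact mul_pos (by linarith) (by linarith)
  · have : (k : ℝ) + 1 < i := by
      have : k + 1 < i := by omega
      exact_mod_cast this
    push_cast
    exact mul_pos_of_neg_of_neg (by linarith) (by linarith)

/-- P'/P is the sum of the p + 1 positive terms 1/(x - i), the largest being 1/(x - p). This locates
the root of P = tP' beyond p. From here on p is mostly the last grid point, so clusters have p + 1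
nodes. -/
theorem eval_gridPoly_bounds {p : ℕ} {x : ℝ} (hx : (p : ℝ) < x) :
    0 < (gridPoly (p + 1)).eval x ∧
      (gridPoly (p + 1)).eval x ≤ (x - p) * (derivative (gridPoly (p + 1))).eval x ∧
      (x - p) * (derivative (gridPoly (p + 1))).eval x ≤ (p + 1) * (gridPoly (p + 1)).eval x := by
  have hpos : ∀ i ∈ range (p + 1), (0 : ℝ) < x - i ∧ x - p ≤ x - i := fun i hi => by
    have : (i : ℝ) ≤ p := by exact_mod_cast Nat.lt_succ_iff.1 (mem_range.1 hi)
    constructor <;> linarith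
  have hprod : ∀ i ∈ range (p + 1), 0 < ∏ j ∈ (range (p + 1)).erase i, (x - (j : ℝ)) :=
    fun i _ => prod_pos fun j hj => (hpos j (mem_of_mem_erase hj)).1
  have hsplit : ∀ i ∈ range (p + 1),
      (x - i) * ∏ j ∈ (range (p + 1)).erase i, (x - (j : ℝ)) = (gridPoly (p + 1)).eval x :=
    fun i hi => by
      rw [gridPoly, eval_nodal]
      exact mul_prod_erase (range (p + 1)) (fun j : ℕ => x - (j : ℝ)) hi
  have hder : (derivative (gridPoly (p + 1))).eval x =
      ∑ i ∈ range (p + 1), ∏ j ∈ (range (p + 1)).erase i, (x - (j : ℝ)) := by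
    simp only [gridPoly, derivative_nodal, eval_finsetSum, eval_nodal]
  have hp : p ∈ range (p + 1) := by simp
  refine ⟨?_, ?_, ?_⟩
  · rw [gridPoly, eval_nodal]
    exact prod_pos fun j hj => (hpos j hj).1
  · rw [← hsplit p hp, hder]
    exact mul_le_mul_of_nonneg_left
      (single_le_sum (f := fun i => ∏ j ∈ (range (p + 1)).erase i, (x - (j : ℝ)))
        (fun i hi => (hprod i hi).le) hp) (hpos p hp).1.le
  · rw [hder, mul_sum]
    calc _ ≤ ∑ i ∈ range (p + 1), (gridPoly (p + 1)).eval x := by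
          refine sum_le_sum fun i hi => ?_
          rw [← hsplit i hi]
          exact mul_le_mul_of_nonneg_right (hpos i hi).2 (hprod i hi).le
      _ = _ := by simp

theorem exists_mem_Ioo_eq_zero_of_mul_neg {g : ℝ → ℝ} (hg : Continuous g) {a b : ℝ} (hab : a < b)
    (h : g a * g b < 0) : ∃ x ∈ Set.Ioo a b, g x = 0 := by
  rcases mul_neg_iff.1 h with ⟨h1, h2⟩ | ⟨h1, h2⟩
  · exact intermediate_value_Ioo' hab.le hg.continuousOn ⟨h2, h1⟩
  · exact intermediate_value_Ioo hab.le hg.continuousOn ⟨h1, h2⟩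

/-- The roots of `P - t P'` interlace those of `P = X (X - 1) ⋯ (X - p)`. -/
theorem exists_interlacing_roots (p : ℕ) {t : ℝ} (ht : 0 < t) :
    ∃ v : ℕ → ℝ, (∀ k ≤ p, (k : ℝ) < v k) ∧ (∀ k < p, v k < k + 1) ∧
      p + t ≤ v p ∧ v p ≤ p + (p + 1) * t ∧
      ∀ k ≤ p, (gridPoly (p + 1)).eval (v k) =
        t * (derivative (gridPoly (p + 1))).eval (v k) := by
  set P := gridPoly (p + 1) with hP
  set g : ℝ → ℝ := fun x => P.eval x - t * (derivative P).eval x with hg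
  have hgc : Continuous g := by fun_prop
  have hgk : ∀ k ≤ p, g k = - t * (derivative P).eval (k : ℝ) := fun k hk => by
    simp only [hg]
    rw [eval_gridPoly_natCast (by omega : k < p + 1)]; ring
  have hlow : ∀ k < p, ∃ x ∈ Set.Ioo (k : ℝ) (k + 1), g x = 0 := by
    intro k hk
    have h1 := eval_derivative_gridPoly_mul_succ_neg (p := p + 1) (k := k) (by omega)
    refine exists_mem_Ioo_eq_zero_of_mul_neg hgc (by linarith) ?_
    rw [← Nat.cast_succ, hgk k hk.le, hgk (k + 1) hk]
    have : 0 < t ^ 2 := by positivity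
    calc _ = t ^ 2 * _ := by ring
      _ < 0 := mul_neg_of_pos_of_neg this h1
  have htop : ∃ x, (p : ℝ) < x ∧ x ≤ p + (p + 1) * t ∧ g x = 0 := by
    have hpt : (0 : ℝ) < (p + 1) * t := by positivity
    have hb := eval_gridPoly_bounds (p := p) (x := p + (p + 1) * t) (by linarith)
    have h0 : g p < 0 := by
      rw [hgk p le_rfl]
      have : 0 < (derivative P).eval (p : ℝ) := by
        rw [eval_derivative_gridPoly_natCast (by omega : p < p + 1)]
        refine prod_pos fun i hi => ?_
        simp only [mem_erase, mem_range] at hi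
        have : i < p := by omega
        rw [sub_pos]
        exact_mod_cast this
      nlinarith
    have h1 : 0 ≤ g (p + (p + 1) * t) := by
      have h2 := hb.2.2
      rw [add_sub_cancel_left, mul_assoc] at h2
      have := le_of_mul_le_mul_left h2 (by positivity)
      simp only [hg]
      linarith
    obtain ⟨x, hx, hx0⟩ := intermediate_value_Icc (by linarith) hgc.continuousOn ⟨h0.le, h1⟩
    refine ⟨x, lt_of_le_of_ne hx.1 ?_, hx.2, hx0⟩
    rintro rfl
    exact h0.ne hx0
  choose! w hw hw0 using hlow
  obtain ⟨z, hz1, hz2, hz0⟩ := htop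
  refine ⟨fun k => if k < p then w k else z, ?_, ?_, ?_, ?_, ?_⟩
  · intro k hk
    rcases hk.lt_or_eq with h | rfl
    · simpa [h] using (hw k h).1
    · simpa using hz1
  · intro k hk
    simpa [hk] using (hw k hk).2
  · have hb := eval_gridPoly_bounds hz1
    have hz : P.eval z = t * (derivative P).eval z := by
      have := hz0; simp only [hg] at this; linarith
    rw [← hP, hz] at hb
    have hd : 0 < (derivative P).eval z := by
      have := hb.1
      exact (mul_pos_iff_of_pos_left ht).1 this
    have := le_of_mul_le_mul_right hb.2.1 hd
    simp only [lt_irrefl, if_false]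
    linarith
  · simpa using hz2
  · intro k hk
    rcases hk.lt_or_eq with h | rfl
    · have := hw0 k h
      simp only [hg] at this
      simp only [h, if_true]
      linarith
    · have := hz0
      simp only [hg] at this
      simp only [lt_irrefl, if_false]
      linarith

/-- Factor by factor: x - i ≥ (p - i) + t ≥ (p - i)(1 + t/(p + 1)), because p - i ≤ p + 1. -/
theorem eval_gridPoly_succ_top_le {p : ℕ} {t x : ℝ} (ht : 0 ≤ t) (hx : p + t ≤ x) :
    (derivative (gridPoly (p + 1))).eval (p : ℝ) * (1 + t / (p + 1)) ^ p ≤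
      (nodal ((range (p + 1)).erase p) (fun i => (i : ℝ))).eval x := by
  have he : (range (p + 1)).erase p = range p := by ext i; simp; omega
  rw [eval_derivative_gridPoly_natCast (by omega), eval_nodal, he]
  have : (1 + t / ((p : ℝ) + 1)) ^ p = ∏ i ∈ range p, (1 + t / ((p : ℝ) + 1)) := by simp
  rw [this, ← prod_mul_distrib]
  refine prod_le_prod (fun i hi => ?_) (fun i hi => ?_)
  all_goals
    have hi' : (i : ℝ) < p := by exact_mod_cast mem_range.1 hi
  · exact mul_nonneg (by linarith) (by positivity)
  · have h0 : (0 : ℝ) ≤ i := by positivity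
    have : ((p : ℝ) - i) * (t / (p + 1)) ≤ t := by
      rw [mul_div_assoc', div_le_iff₀ (by positivity)]
      nlinarith
    linarith

/-! ### The perturbed cluster. -/

/-- Amplitudes of the unperturbed cluster with nodes `0, …, p`. -/
def gridAmp (p k : ℕ) : ℝ :=
  (((derivative (gridPoly (p + 1))).eval (k : ℝ)) ^ 2)⁻¹

theorem gridAmp_pos {p k : ℕ} (hk : k ≤ p) : 0 < gridAmp p k :=
  inv_pos.2 (pow_two_pos_of_ne_zero
    (eval_derivative_gridPoly_natCast_ne_zero (Nat.lt_succ_of_le hk)))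

theorem natCast_ne_of_interlacing {p : ℕ} {v : ℕ → ℝ} (h1 : ∀ k ≤ p, (k : ℝ) < v k)
    (h2 : ∀ k < p, v k < k + 1) {i k : ℕ} (hi : i ≤ p) (hk : k ≤ p) : (i : ℝ) ≠ v k := by
  rcases le_or_gt i k with h | h
  · have : (i : ℝ) ≤ k := by exact_mod_cast h
    exact (this.trans_lt (h1 k hk)).ne
  · have : (k : ℝ) + 1 ≤ i := by exact_mod_cast h
    exact ((h2 k (by omega)).trans_le this).ne'

theorem lt_of_interlacing {p : ℕ} {v : ℕ → ℝ} (h1 : ∀ k ≤ p, (k : ℝ) < v k)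
    (h2 : ∀ k < p, v k < k + 1) {i k : ℕ} (hik : i < k) (hk : k ≤ p) : v i < v k := by
  have : (i : ℝ) + 1 ≤ k := by exact_mod_cast hik
  linarith [h1 k hk, h2 i (by omega)]

theorem gridPoly_sub_eq_nodal {p : ℕ} {t : ℝ} (ht : t ≠ 0) {v : ℕ → ℝ}
    (hv : Set.InjOn v (range (p + 1)))
    (h : ∀ k ≤ p, (gridPoly (p + 1)).eval (v k) =
      t * (derivative (gridPoly (p + 1))).eval (v k)) :
    gridPoly (p + 1) - C t * derivative (gridPoly (p + 1)) = nodal (range (p + 1)) v := by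
  -- Both sides are monic of degree p + 1, so their difference has degree at most p and p + 1 zeros.
  refine eq_of_degree_sub_lt_of_eval_index_eq (range (p + 1)) hv ?_ fun k hk => ?_
  · rw [sub_right_comm]
    have hd : (gridPoly (p + 1)).degree = ((range (p + 1)).card : WithBot ℕ) := degree_nodal
    refine (degree_sub_le _ _).trans_lt (max_lt ?_ ?_)
    · rw [← hd]
      refine degree_sub_lt_left (hd.trans degree_nodal.symm) nodal_ne_zero ?_
      rw [gridPoly, nodal_monic.leadingCoeff, nodal_monic.leadingCoeff]
    · refine lt_of_le_of_lt ?_ (degree_derivative_lt nodal_ne_zero |>.trans_eq hd)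
      rw [degree_C_mul ht, gridPoly]
  · rw [eval_nodal_at_node hk, eval_sub, eval_mul, eval_C,
      h k (Nat.lt_succ_iff.1 (mem_range.1 hk)), sub_self]

/-- The difference of two measures whose nodes are the roots of `P` and of `P - t P'` is a multiple
of a divided difference. -/
theorem norm_sum_sub_sum_exp_le {p : ℕ} {t : ℝ} (ht : 0 < t) {v : ℕ → ℝ}
    (h1 : ∀ k ≤ p, (k : ℝ) < v k) (h2 : ∀ k < p, v k < k + 1)
    (h : ∀ k ≤ p, (gridPoly (p + 1)).eval (v k) =
      t * (derivative (gridPoly (p + 1))).eval (v k)) (ω : ℝ) :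
    ‖∑ k ∈ range (p + 1), ((((derivative (gridPoly (p + 1))).eval (v k) ^ 2 -
        (gridPoly (p + 1)).eval (v k) *
          (derivative (derivative (gridPoly (p + 1)))).eval (v k))⁻¹ : ℝ) : ℂ) *
          Complex.exp ((ω * v k : ℝ) * Complex.I) -
      ∑ k ∈ range (p + 1), (gridAmp p k : ℂ) * Complex.exp ((ω * k : ℝ) * Complex.I)‖ ≤
      2 * t * |ω| ^ (2 * p + 1) := by
  set P := gridPoly (p + 1) with hP
  have hv : Set.InjOn v (range (p + 1)) := by
    intro i hi k hk hik
    have hi := Nat.lt_succ_iff.1 (mem_range.1 hi)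
    have hk := Nat.lt_succ_iff.1 (mem_range.1 hk)
    rcases lt_trichotomy i k with hl | hl | hl
    · exact absurd hik (lt_of_interlacing h1 h2 hl hk).ne
    · exact hl
    · exact absurd hik (lt_of_interlacing h1 h2 hl hi).ne'
  have hQ := gridPoly_sub_eq_nodal ht.ne' hv h
  rw [← hP] at hQ
  -- The grid followed by the perturbed nodes: 2p + 2 points, hence a divided difference of order 2p
  -- + 1.
  set y : ℕ → ℝ := fun i => if i < p + 1 then (i : ℝ) else v (i - (p + 1)) with hy
  have hy1 : ∀ i < p + 1, y i = i := fun i hi => if_pos hi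
  have hy2 : ∀ i, y (p + 1 + i) = v i := fun i => by
    simp only [hy, Nat.add_sub_cancel_left]
    exact if_neg (by omega)
  have hyinj : Set.InjOn y (range (p + 1 + (p + 1))) := by
    intro i hi k hk hik
    simp only [coe_range, Set.mem_Iio] at hi hk
    rcases lt_or_ge i (p + 1) with ha | ha <;> rcases lt_or_ge k (p + 1) with hb | hb
    · rw [hy1 i ha, hy1 k hb] at hik
      exact_mod_cast hik
    · obtain ⟨k, rfl⟩ := Nat.exists_eq_add_of_le hb
      rw [hy1 i ha, hy2] at hik
      exact absurd hik (natCast_ne_of_interlacing h1 h2 (by omega) (by omega))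
    · obtain ⟨i, rfl⟩ := Nat.exists_eq_add_of_le ha
      rw [hy1 k hb, hy2] at hik
      exact absurd hik.symm (natCast_ne_of_interlacing h1 h2 (by omega) (by omega))
    · obtain ⟨k, rfl⟩ := Nat.exists_eq_add_of_le hb
      obtain ⟨i, rfl⟩ := Nat.exists_eq_add_of_le ha
      rw [hy2, hy2] at hik
      rw [hv (by simp; omega) (by simp; omega) hik]
  have hnod : nodal (range (p + 1 + (p + 1))) y = P * (P - C t * derivative P) := by
    rw [hQ, nodal, prod_range_add, hP, gridPoly, nodal, nodal]
    congr 1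
    · exact prod_congr rfl fun i hi => by rw [hy1 i (mem_range.1 hi)]
    · exact prod_congr rfl fun i hi => by rw [hy2]
  -- With Q = P - tP' and P(k) = 0, (PQ)'(k) = P'(k)Q(k) = -tP'(k)².
  have hw1 : ∀ k ∈ range (p + 1),
      nodalWeight (range (p + 1 + (p + 1))) y k = -(t⁻¹ * gridAmp p k) := fun k hk => by
    have hk' := mem_range.1 hk
    rw [nodalWeight_eq_eval_derivative_nodal (by simp; omega), hnod, hy1 k hk', gridAmp, ← hP]
    simp only [derivative_mul, derivative_sub, eval_add, eval_mul, eval_sub, eval_C]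
    rw [hP, eval_gridPoly_natCast hk', ← hP, ← mul_inv, ← inv_neg]
    congr 1
    ring
  -- Here Q vanishes, so (PQ)' = PQ' = tP'(P' - tP'') = t(P'² - PP''), using P = tP' twice.
  have hw2 : ∀ k ∈ range (p + 1),
      nodalWeight (range (p + 1 + (p + 1))) y (p + 1 + k) =
        t⁻¹ * ((derivative P).eval (v k) ^ 2 -
          P.eval (v k) * (derivative (derivative P)).eval (v k))⁻¹ := fun k hk => by
    have hk' := mem_range.1 hk
    rw [nodalWeight_eq_eval_derivative_nodal (by simp; omega), hnod, hy2]
    simp only [derivative_mul, derivative_sub, derivative_C, eval_add, eval_mul, eval_sub, eval_C,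
      zero_mul, zero_add]
    rw [← mul_inv]
    congr 1
    rw [h k (by omega)]
    ring
  have hmain := norm_sum_nodalWeight_mul_exp_le hyinj (n := 2 * p + 1) (by simp; omega) ω
  rw [sum_range_add] at hmain
  have hs1 : ∑ k ∈ range (p + 1), ((nodalWeight (range (p + 1 + (p + 1))) y k : ℝ) : ℂ) *
      Complex.exp ((ω * y k : ℝ) * Complex.I) = -((t⁻¹ : ℝ) : ℂ) *
        ∑ k ∈ range (p + 1), (gridAmp p k : ℂ) * Complex.exp ((ω * k : ℝ) * Complex.I) := by
    rw [mul_sum]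
    refine sum_congr rfl fun k hk => ?_
    rw [hw1 k hk, hy1 k (mem_range.1 hk)]
    push_cast
    ring
  have hs2 : ∑ k ∈ range (p + 1),
      ((nodalWeight (range (p + 1 + (p + 1))) y (p + 1 + k) : ℝ) : ℂ) *
      Complex.exp ((ω * y (p + 1 + k) : ℝ) * Complex.I) = ((t⁻¹ : ℝ) : ℂ) *
        ∑ k ∈ range (p + 1), ((((derivative P).eval (v k) ^ 2 -
          P.eval (v k) * (derivative (derivative P)).eval (v k))⁻¹ : ℝ) : ℂ) *
          Complex.exp ((ω * v k : ℝ) * Complex.I) := by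
    rw [mul_sum]
    refine sum_congr rfl fun k hk => ?_
    rw [hw2 k hk, hy2]
    push_cast
    ring
  rw [hs1, hs2, neg_mul, neg_add_eq_sub, ← mul_sub, norm_mul, Complex.norm_real, Real.norm_eq_abs,
    abs_of_pos (inv_pos.2 ht), inv_mul_le_iff₀ ht] at hmain
  linarith

/-- A perturbation of the equally spaced cluster which moves the last node by at least `t` and the
last amplitude by a multiple of `t`, while its Fourier transform is flat of order `2 p + 1`. -/
theorem exists_cluster_perturbation {p : ℕ} (hp : 1 ≤ p) {t : ℝ} (ht : 0 < t) (ht1 : t ≤ 1) :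
    ∃ v b : ℕ → ℝ, (∀ k ≤ p, (k : ℝ) < v k) ∧ (∀ k < p, v k < k + 1) ∧
      p + t ≤ v p ∧ v p ≤ p + (p + 1) * t ∧ (∀ k ≤ p, 0 < b k) ∧
      b p ≤ gridAmp p p * (1 - t / (2 * (p + 1))) ∧
      ∀ ω : ℝ, ‖∑ k ∈ range (p + 1), (b k : ℂ) * Complex.exp ((ω * v k : ℝ) * Complex.I) -
        ∑ k ∈ range (p + 1), (gridAmp p k : ℂ) * Complex.exp ((ω * k : ℝ) * Complex.I)‖ ≤
        2 * t * |ω| ^ (2 * p + 1) := by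
  obtain ⟨v, h1, h2, h3, h4, h5⟩ := exists_interlacing_roots p ht
  have hlag : ∀ k ≤ p, ∀ x, _ := fun k hk x =>
    sq_eval_nodal_erase_le (range (p + 1)) (fun i : ℕ => (i : ℝ)) x
      (mem_range.2 (Nat.lt_succ_of_le hk))
  refine ⟨v, fun k => ((derivative (gridPoly (p + 1))).eval (v k) ^ 2 -
        (gridPoly (p + 1)).eval (v k) *
          (derivative (derivative (gridPoly (p + 1)))).eval (v k))⁻¹, h1, h2, h3, h4, ?_, ?_,
          norm_sum_sub_sum_exp_le ht h1 h2 h5⟩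
  · intro k hk
    refine inv_pos.2 (lt_of_lt_of_le ?_ (hlag k hk (v k)))
    refine pow_two_pos_of_ne_zero ?_
    rw [eval_nodal, prod_ne_zero_iff]
    intro i hi
    have hi := mem_range.1 (mem_of_mem_erase hi)
    exact sub_ne_zero.2 (natCast_ne_of_interlacing h1 h2 (by omega) hk).symm
  · have hA := eval_gridPoly_succ_top_le ht.le h3
    have hB := hlag p le_rfl (v p)
    have hD := gridAmp_pos (le_refl p)
    rw [gridAmp] at hD ⊢
    set a := (derivative (gridPoly (p + 1))).eval (p : ℝ) with ha
    have ha0 : 0 < a := by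
      rw [ha, eval_derivative_gridPoly_natCast (Nat.lt_succ_self p)]
      refine prod_pos fun i hi => ?_
      simp only [mem_erase, mem_range] at hi
      have : i < p := by omega
      exact sub_pos.2 (by exact_mod_cast this)
    set y := t / ((p : ℝ) + 1) with hy
    have hy0 : 0 < y := by positivity
    have hy1 : y ≤ 1 := by
      rw [hy, div_le_one (by positivity)]
      have : (0 : ℝ) ≤ p := by positivity
      linarith
    have hpow : 1 + y ≤ (1 + y) ^ p := le_self_pow₀ (by linarith) (by omega)
    have hC : a * (1 + y) ≤ _ := (mul_le_mul_of_nonneg_left hpow ha0.le).trans hA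
    have hE := (pow_le_pow_left₀ (by positivity) hC 2).trans hB
    have hty : t / (2 * ((p : ℝ) + 1)) = y / 2 := by rw [hy]; field_simp
    rw [hty]
    refine (inv_anti₀ (by positivity) hE).trans ?_
    rw [mul_pow, mul_inv]
    refine mul_le_mul_of_nonneg_left ?_ hD.le
    -- What remains is (1 - y/2)(1 + y)² = 1 + 3y/2 - y³/2 ≥ 1 on [0, 1].
    rw [inv_le_iff_one_le_mul₀ (by positivity)]
    nlinarith [mul_nonneg hy0.le (sub_nonneg.2 hy1), mul_nonneg hy0.le hy0.le,
      mul_nonneg (mul_nonneg hy0.le hy0.le) (sub_nonneg.2 hy1)]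

/-! ### Error sets and perturbations of a single node or amplitude. -/

theorem norm_exp_mul_I_sub_le (a b : ℝ) :
    ‖Complex.exp (a * Complex.I) - Complex.exp (b * Complex.I)‖ ≤ |a - b| := by
  have h : Complex.exp (a * Complex.I) - Complex.exp (b * Complex.I) =
      Complex.exp (b * Complex.I) * (Complex.exp (Complex.I * ((a - b : ℝ) : ℂ)) - 1) := by
    rw [mul_sub, ← Complex.exp_add, mul_one]
    congr 2
    push_cast
    ring
  rw [h, norm_mul, Complex.norm_exp_ofReal_mul_I, one_mul]
  exact Real.norm_exp_I_mul_ofReal_sub_one_le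

namespace PosSignal

variable {d : ℕ}

theorem fourier_eq_sum (F : PosSignal d) (s : ℝ) :
    F.fourier s =
      ∑ j, (F.amp j : ℂ) * Complex.exp ((-2 * Real.pi * s * F.node j : ℝ) * Complex.I) := by
  rw [fourier, toMeasure, integral_finsetSum_measure]
  · refine sum_congr rfl fun j _ => ?_
    rw [integral_smul_measure, integral_dirac, ENNReal.toReal_ofReal (F.amp_pos j).le,
      Complex.real_smul]
    push_cast
    ring_nf
  · intro j _
    exact (integrable_dirac (by simp)).smul_measure ENNReal.ofReal_ne_top

theorem mem_errorSet_self {ε : ℝ} (hε : 0 ≤ ε) (Ω : ℝ) (F : PosSignal d) :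
    F ∈ F.errorSet ε Ω := fun s _ => by simpa using hε

/-- One competitor suffices, since F belongs to its own error set. -/
theorem le_ediam_nodeErrorSet {F G : PosSignal d} {ε Ω c : ℝ} (hε : 0 ≤ ε)
    (hG : G ∈ F.errorSet ε Ω) (j : Fin d) (hc : c ≤ |G.node j - F.node j|) :
    ENNReal.ofReal c ≤ Metric.ediam (F.nodeErrorSet ε Ω j) := by
  refine le_trans ?_ (Metric.edist_le_ediam_of_mem (Set.mem_image_of_mem _ hG)
    (Set.mem_image_of_mem _ (mem_errorSet_self hε Ω F)))
  rw [edist_dist, Real.dist_eq]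
  exact ENNReal.ofReal_le_ofReal hc

theorem le_ediam_ampErrorSet {F G : PosSignal d} {ε Ω c : ℝ} (hε : 0 ≤ ε)
    (hG : G ∈ F.errorSet ε Ω) (j : Fin d) (hc : c ≤ |G.amp j - F.amp j|) :
    ENNReal.ofReal c ≤ Metric.ediam (F.ampErrorSet ε Ω j) := by
  refine le_trans ?_ (Metric.edist_le_ediam_of_mem (Set.mem_image_of_mem _ hG)
    (Set.mem_image_of_mem _ (mem_errorSet_self hε Ω F)))
  rw [edist_dist, Real.dist_eq]
  exact ENNReal.ofReal_le_ofReal hc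

/-- Changing one amplitude of a signal by at most `ε` stays in the error set. -/
theorem le_ediam_ampErrorSet_of_le {F : PosSignal d} {ε c : ℝ} (hε : 0 ≤ ε) (Ω : ℝ) (j : Fin d)
    (hc : c ≤ ε) : ENNReal.ofReal c ≤ Metric.ediam (F.ampErrorSet ε Ω j) := by
  set G : PosSignal d := ⟨Function.update F.amp j (F.amp j + ε), F.node, fun i => by
    by_cases h : i = j
    · subst h
      simpa using add_pos_of_pos_of_nonneg (F.amp_pos i) hε
    · simpa [h] using F.amp_pos i, F.node_strictMono⟩ with hG
  refine le_ediam_ampErrorSet (G := G) hε (fun s _ => ?_) j ?_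
  · rw [fourier_eq_sum, fourier_eq_sum, ← sum_sub_distrib, sum_eq_single j]
    · simp only [hG, Function.update_self, ← sub_mul]
      rw [norm_mul, Complex.norm_exp_ofReal_mul_I, mul_one, Complex.ofReal_add,
        add_sub_cancel_left, Complex.norm_real, Real.norm_eq_abs, abs_of_nonneg hε]
    · intro i _ hi
      simp [hG, hi]
    · simp
  · simpa [hG] using hc.trans (le_abs_self ε)

/-- Moving to the right one node which is isolated there. -/
theorem le_ediam_nodeErrorSet_of_gap {F : PosSignal d} {ε Ω δ c : ℝ} (hε : 0 ≤ ε) (hδ : 0 ≤ δ)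
    (j : Fin d) (hgap : ∀ k, j < k → F.node j + δ < F.node k)
    (hδε : F.amp j * (2 * Real.pi * Ω * δ) ≤ ε) (hc : c ≤ δ) :
    ENNReal.ofReal c ≤ Metric.ediam (F.nodeErrorSet ε Ω j) := by
  set G : PosSignal d := ⟨F.amp, Function.update F.node j (F.node j + δ), F.amp_pos, by
    intro i k hik
    by_cases h1 : i = j
    · subst h1
      simpa [hik.ne'] using hgap k hik
    · by_cases h2 : k = j
      · subst h2
        simp only [Function.update_self, Function.update_of_ne h1]
        linarith [F.node_strictMono hik]
      · simpa [h1, h2] using F.node_strictMono hik⟩ with hG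
  refine le_ediam_nodeErrorSet (G := G) hε (fun s hs => ?_) j ?_
  · rw [fourier_eq_sum, fourier_eq_sum, ← sum_sub_distrib, sum_eq_single j]
    · simp only [hG, Function.update_self, ← mul_sub]
      rw [norm_mul, Complex.norm_real, Real.norm_eq_abs, abs_of_pos (F.amp_pos j)]
      refine le_trans (mul_le_mul_of_nonneg_left ?_ (F.amp_pos j).le) hδε
      refine (norm_exp_mul_I_sub_le _ _).trans ?_
      have he : -2 * Real.pi * s * (F.node j + δ) - -2 * Real.pi * s * F.node j =
          -(2 * Real.pi * δ * s) := by ring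
      have hpos : 0 ≤ 2 * Real.pi * δ := by positivity
      rw [he, abs_neg, abs_mul, abs_of_nonneg hpos]
      calc _ ≤ 2 * Real.pi * δ * Ω :=
            mul_le_mul_of_nonneg_left (abs_le.2 ⟨hs.1, hs.2⟩) hpos
        _ = _ := by ring
    · intro i _ hi
      simp [hG, hi]
    · simp
  · simpa [hG] using hc.trans (le_abs_self δ)

end PosSignal

/-! ### Embedding the cluster in a signal with d nodes. -/

/-- A cluster `Δ v 0 < ⋯ < Δ v p`, placed at the indices `κ, …, κ + p`, with nodes of spacing `g` on
both sides. -/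
def spreadNode (p κ : ℕ) (g Δ : ℝ) (v : ℕ → ℝ) (j : ℕ) : ℝ :=
  if j < κ then ((j : ℝ) - κ) * g
  else if j ≤ κ + p then Δ * v (j - κ)
  else Δ * p + ((j : ℝ) - κ - p) * g

/-- Amplitudes `b 0, …, b p` placed at the indices `κ, …, κ + p`, and `m` elsewhere. -/
def spreadAmp (p κ : ℕ) (m : ℝ) (b : ℕ → ℝ) (j : ℕ) : ℝ :=
  if κ ≤ j ∧ j ≤ κ + p then b (j - κ) else m

theorem spreadNode_strictMono {p κ : ℕ} {g Δ : ℝ} {v : ℕ → ℝ} (hg : 0 < g) (hΔ : 0 < Δ)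
    (hv : ∀ i k, i < k → k ≤ p → v i < v k) (h0 : 0 ≤ v 0) (hp : Δ * v p < Δ * p + g) :
    StrictMono (spreadNode p κ g Δ v) := by
  have h0' : ∀ k ≤ p, 0 ≤ v k := fun k hk => by
    rcases k.eq_zero_or_pos with rfl | h
    · exact h0
    · exact h0.trans (hv 0 k h hk).le
  have hp' : ∀ k ≤ p, v k ≤ v p := fun k hk => by
    rcases hk.eq_or_lt with rfl | h
    · exact le_rfl
    · exact (hv k p h le_rfl).le
  intro i k hik
  have hik' : (i : ℝ) + 1 ≤ k := by exact_mod_cast hik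
  unfold spreadNode
  by_cases hi : i < κ
  · have hi' : (i : ℝ) < κ := by exact_mod_cast hi
    have hneg : ((i : ℝ) - κ) * g < 0 := mul_neg_of_neg_of_pos (by linarith) hg
    rw [if_pos hi]
    by_cases hk : k < κ
    · rw [if_pos hk]
      exact mul_lt_mul_of_pos_right (by linarith) hg
    · rw [if_neg hk]
      by_cases hk2 : k ≤ κ + p
      · rw [if_pos hk2]
        exact hneg.trans_le (mul_nonneg hΔ.le (h0' _ (by omega)))
      · rw [if_neg hk2]
        have : (κ : ℝ) + p < k := by exact_mod_cast not_le.1 hk2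
        refine hneg.trans_le (add_nonneg (by positivity) (mul_nonneg (by linarith) hg.le))
  · rw [if_neg hi, if_neg (by omega : ¬ k < κ)]
    by_cases hi2 : i ≤ κ + p
    · rw [if_pos hi2]
      by_cases hk2 : k ≤ κ + p
      · rw [if_pos hk2]
        exact mul_lt_mul_of_pos_left (hv _ _ (by omega) (by omega)) hΔ
      · rw [if_neg hk2]
        have : (κ : ℝ) + p + 1 ≤ k := by exact_mod_cast not_le.1 hk2
        have h1 := mul_le_mul_of_nonneg_left (hp' (i - κ) (by omega)) hΔ.le
        nlinarith
    · rw [if_neg hi2, if_neg (by omega)]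
      have := mul_lt_mul_of_pos_right (by linarith : (i : ℝ) - κ - p < k - κ - p) hg
      linarith

theorem spreadNode_natCast_gap {p κ : ℕ} {g Δ : ℝ} (hg : 0 < g) (hΔ : 0 < Δ) {i k : ℕ}
    (hik : i < k) (h : ¬ (κ ≤ i ∧ i ≤ κ + p) ∨ ¬ (κ ≤ k ∧ k ≤ κ + p)) :
    spreadNode p κ g Δ (fun i => (i : ℝ)) i + g ≤ spreadNode p κ g Δ (fun i => (i : ℝ)) k := by
  have hik' : (i : ℝ) + 1 ≤ k := by exact_mod_cast hik
  unfold spreadNode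
  by_cases hi : i < κ
  · have hi' : (i : ℝ) + 1 ≤ κ := by exact_mod_cast hi
    have hneg : ((i : ℝ) - κ + 1) * g ≤ 0 := mul_nonpos_of_nonpos_of_nonneg (by linarith) hg.le
    rw [if_pos hi]
    by_cases hk : k < κ
    · rw [if_pos hk]
      nlinarith
    · rw [if_neg hk]
      by_cases hk2 : k ≤ κ + p
      · rw [if_pos hk2]
        have : 0 ≤ Δ * ((k - κ : ℕ) : ℝ) := by positivity
        linarith
      · rw [if_neg hk2]
        have : (κ : ℝ) + p < k := by exact_mod_cast not_le.1 hk2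
        have : 0 ≤ Δ * (p : ℝ) + ((k : ℝ) - κ - p) * g :=
          add_nonneg (by positivity) (mul_nonneg (by linarith) hg.le)
        linarith
  · rw [if_neg hi, if_neg (by omega : ¬ k < κ), if_neg (by omega : ¬ k ≤ κ + p)]
    by_cases hi2 : i ≤ κ + p
    · rw [if_pos hi2]
      have : (κ : ℝ) + p + 1 ≤ k := by
        have : κ + p + 1 ≤ k := by omega
        exact_mod_cast this
      have h1 : Δ * ((i - κ : ℕ) : ℝ) ≤ Δ * p :=
        mul_le_mul_of_nonneg_left (by exact_mod_cast (by omega : i - κ ≤ p)) hΔ.le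
      nlinarith
    · rw [if_neg hi2]
      nlinarith

theorem spreadNode_natCast_mem_Icc {d p κ : ℕ} {g Δ : ℝ} (hg : 0 < g) (hΔ : 0 < Δ) {j : ℕ}
    (hj : j < d) (hd : κ + (p + 1) ≤ d) :
    spreadNode p κ g Δ (fun i => (i : ℝ)) j ∈
      Set.Icc (-(κ * g)) (Δ * p + ((d : ℝ) - 1 - κ - p) * g) := by
  have hd' : (κ : ℝ) + (p + 1) ≤ d := by exact_mod_cast hd
  have hj' : (j : ℝ) + 1 ≤ d := by exact_mod_cast hj
  have hκ : 0 ≤ (κ : ℝ) * g := by positivity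
  have hp : 0 ≤ Δ * (p : ℝ) := by positivity
  have hr : 0 ≤ ((d : ℝ) - 1 - κ - p) * g := mul_nonneg (by linarith) hg.le
  unfold spreadNode
  split_ifs with h1 h2
  · have h1' : (j : ℝ) < κ := by exact_mod_cast h1
    have h2 : ((j : ℝ) - κ) * g ≤ 0 := mul_nonpos_of_nonpos_of_nonneg (by linarith) hg.le
    have h3 : 0 ≤ (j : ℝ) * g := by positivity
    constructor <;> linarith
  · have h3 : 0 ≤ Δ * ((j - κ : ℕ) : ℝ) := by positivity
    have h4 : Δ * ((j - κ : ℕ) : ℝ) ≤ Δ * p :=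
      mul_le_mul_of_nonneg_left (by exact_mod_cast (by omega : j - κ ≤ p)) hΔ.le
    constructor <;> linarith
  · have h2' : (κ : ℝ) + p < j := by exact_mod_cast not_le.1 h2
    have h3 : 0 ≤ ((j : ℝ) - κ - p) * g := mul_nonneg (by linarith) hg.le
    have h4 : ((j : ℝ) - κ - p) * g ≤ ((d : ℝ) - 1 - κ - p) * g :=
      mul_le_mul_of_nonneg_right (by linarith) hg.le
    constructor <;> linarith

/-- The cluster has length τhp ≤ h and the other d - 1 - p gaps equal g, so the whole configuration
has length at most h + (d - 1)g. -/
theorem isClustered_spreadNode {d p κ : ℕ} {h T τ η g : ℝ} (hp : 1 ≤ p) (hd : κ + (p + 1) ≤ d)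
    (hτ : 0 < τ) (hτp : τ * p ≤ 1) (hη : 0 < η) (hη1 : η ≤ 1) (hh : 0 < h) (hhT : h ≤ T)
    (hg : η * T ≤ g) (hgT : h + ((d : ℝ) - 1) * g ≤ T) :
    IsClustered (p + 1) h T τ η κ
      (fun j : Fin d => spreadNode p κ g (τ * h) (fun i => (i : ℝ)) j) := by
  have hp' : (1 : ℝ) ≤ p := by exact_mod_cast hp
  have hT : 0 < T := hh.trans_le hhT
  have hg0 : 0 < g := (mul_pos hη hT).trans_le hg
  have hΔ : 0 < τ * h := mul_pos hτ hh
  have hΔp : τ * h * p ≤ h := by nlinarith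
  refine ⟨by omega, hd, hτ, by nlinarith, hη, hη1, hh, hhT, ?_, ?_⟩
  · intro j hj k hk hjk
    have hcl : ∀ i ∈ clusterIdx d (p + 1) κ,
        spreadNode p κ g (τ * h) (fun i => (i : ℝ)) i = τ * h * (i - κ : ℕ) := fun i hi => by
      have h1 := hi.1
      have h2 := hi.2
      rw [spreadNode, if_neg (by omega), if_pos (by omega)]
    simp only [hcl j hj, hcl k hk]
    rw [← mul_sub, abs_mul, abs_of_pos hΔ]
    have h1 := hj.1
    have h2 := hj.2
    have h3 := hk.1
    have h4 := hk.2
    have hne : (j : ℕ) ≠ k := fun e => hjk (Fin.ext e)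
    have hlow : (1 : ℝ) ≤ |((j - κ : ℕ) : ℝ) - ((k - κ : ℕ) : ℝ)| := by
      have : (1 : ℤ) ≤ |((j - κ : ℕ) : ℤ) - ((k - κ : ℕ) : ℤ)| :=
        Int.one_le_abs (by omega)
      exact_mod_cast this
    have hup : |((j - κ : ℕ) : ℝ) - ((k - κ : ℕ) : ℝ)| ≤ p := by
      have : |((j - κ : ℕ) : ℤ) - ((k - κ : ℕ) : ℤ)| ≤ p := abs_le.2 ⟨by omega, by omega⟩
      exact_mod_cast this
    exact ⟨by nlinarith, (mul_le_mul_of_nonneg_left hup hΔ.le).trans hΔp⟩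
  · intro l hl j hlj
    have hl' : ¬ (κ ≤ (l : ℕ) ∧ (l : ℕ) ≤ κ + p) := fun e => hl ⟨e.1, by omega⟩
    have hbl := spreadNode_natCast_mem_Icc hg0 hΔ l.2 hd
    have hbj := spreadNode_natCast_mem_Icc hg0 hΔ j.2 hd
    have hpg : 0 ≤ (p : ℝ) * g := by positivity
    constructor
    · refine hg.trans ?_
      rcases lt_or_gt_of_ne hlj with hlt | hlt
      · have := spreadNode_natCast_gap (p := p) hg0 hΔ (Fin.lt_def.1 hlt) (Or.inl hl')
        refine le_trans ?_ (neg_le_abs _)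
        linarith
      · have := spreadNode_natCast_gap (p := p) hg0 hΔ (Fin.lt_def.1 hlt) (Or.inr hl')
        refine le_trans ?_ (le_abs_self _)
        linarith
    · rw [abs_le]
      constructor <;> linarith [hbl.1, hbl.2, hbj.1, hbj.2]

/-- The signal with a cluster `(b, Δ v)` at the indices `κ, …, κ + p`. -/
def spreadSignal (d : ℕ) {p : ℕ} (κ : ℕ) {g Δ m : ℝ} {v b : ℕ → ℝ} (hg : 0 < g) (hΔ : 0 < Δ)
    (hm : 0 < m) (hv : ∀ i k, i < k → k ≤ p → v i < v k) (h0 : 0 ≤ v 0)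
    (hp : Δ * v p < Δ * p + g) (hb : ∀ k ≤ p, 0 < b k) : PosSignal d where
  amp j := spreadAmp p κ m b j
  node j := spreadNode p κ g Δ v j
  amp_pos j := by
    unfold spreadAmp
    split_ifs with h
    · exact hb _ (by omega)
    · exact hm
  node_strictMono := (spreadNode_strictMono hg hΔ hv h0 hp).comp Fin.val_strictMono

/-- The terms outside the cluster do not depend on v and b, so they cancel; the scale Δ passes into
the frequency. -/
theorem sum_spread_sub {d p κ : ℕ} (hd : κ + (p + 1) ≤ d) (g Δ m : ℝ) (v b v' b' : ℕ → ℝ)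
    (c : ℝ) :
    ∑ j : Fin d, (spreadAmp p κ m b j : ℂ) *
        Complex.exp ((c * spreadNode p κ g Δ v j : ℝ) * Complex.I) -
      ∑ j : Fin d, (spreadAmp p κ m b' j : ℂ) *
        Complex.exp ((c * spreadNode p κ g Δ v' j : ℝ) * Complex.I) =
    ∑ k ∈ range (p + 1), (b k : ℂ) * Complex.exp ((c * Δ * v k : ℝ) * Complex.I) -
      ∑ k ∈ range (p + 1), (b' k : ℂ) * Complex.exp ((c * Δ * v' k : ℝ) * Complex.I) := by
  rw [← sum_sub_distrib, ← sum_sub_distrib]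
  rw [Fin.sum_univ_eq_sum_range (fun j => (spreadAmp p κ m b j : ℂ) *
        Complex.exp ((c * spreadNode p κ g Δ v j : ℝ) * Complex.I) -
      (spreadAmp p κ m b' j : ℂ) *
        Complex.exp ((c * spreadNode p κ g Δ v' j : ℝ) * Complex.I)) d]
  rw [← sum_subset (s₁ := Ico κ (κ + (p + 1))), sum_Ico_eq_sum_range, Nat.add_sub_cancel_left]
  · refine sum_congr rfl fun k hk => ?_
    have hk := mem_range.1 hk
    have ha : ∀ b : ℕ → ℝ, spreadAmp p κ m b (κ + k) = b k := fun b => by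
      rw [spreadAmp, if_pos (by omega), Nat.add_sub_cancel_left]
    have hn : ∀ v : ℕ → ℝ, spreadNode p κ g Δ v (κ + k) = Δ * v k := fun v => by
      rw [spreadNode, if_neg (by omega), if_pos (by omega), Nat.add_sub_cancel_left]
    rw [ha, ha, hn, hn, ← mul_assoc, ← mul_assoc]
  · intro j hj
    have := (mem_Ico.1 hj).2
    exact mem_range.2 (by omega)
  · intro j _ hj
    have hj : ¬ (κ ≤ j ∧ j ≤ κ + p) := fun e => hj (mem_Ico.2 ⟨e.1, by omega⟩)
    have ha : ∀ b : ℕ → ℝ, spreadAmp p κ m b j = m := fun b => if_neg hj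
    have hn : spreadNode p κ g Δ v j = spreadNode p κ g Δ v' j := by
      unfold spreadNode
      by_cases h1 : j < κ
      · simp [h1]
      · rw [if_neg h1, if_neg h1, if_neg (by omega), if_neg (by omega)]
    rw [ha, ha, hn, sub_self]

/-! ### Choice of constants and conclusion. -/

theorem exists_max_gridAmp (q : ℕ) : ∃ k₀ ≤ q, ∀ k ≤ q, gridAmp q k ≤ gridAmp q k₀ := by
  obtain ⟨k₀, hk₀, h⟩ := exists_max_image (range (q + 1)) (gridAmp q) ⟨0, by simp⟩
  exact ⟨k₀, by simpa [Nat.lt_succ_iff] using hk₀,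
    fun k hk => h k (mem_range.2 (Nat.lt_succ_of_le hk))⟩

/-- The perturbed cluster yields an element of the error set whose last cluster node and amplitude
are far from the unperturbed ones. -/
theorem exists_mem_errorSet_spreadSignal {d q κ : ℕ} (hq : 1 ≤ q) (hd : κ + (q + 1) ≤ d)
    {g Δ m γ Ω ε t : ℝ} (hg : 0 < g) (hΔ : 0 < Δ) (hm : 0 < m) (hγ : 0 < γ) (hΔg : Δ < g)
    {F : PosSignal d}
    (hFa : ∀ j, F.amp j = spreadAmp q κ m (fun k => γ * gridAmp q k) j)
    (hFx : ∀ j, F.node j = spreadNode q κ g Δ (fun k => (k : ℝ)) j)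
    (ht : 0 < t) (htq : (q + 1) * t ≤ 1)
    (hε : γ * (2 * t * (2 * Real.pi * (Ω * Δ)) ^ (2 * q + 1)) ≤ ε) :
    ∃ G ∈ F.errorSet ε Ω, ∀ j : Fin d, (j : ℕ) = κ + q →
      Δ * t ≤ |G.node j - F.node j| ∧
      γ * gridAmp q q * (t / (2 * (q + 1))) ≤ |G.amp j - F.amp j| := by
  have hq0 : (0 : ℝ) ≤ q := by positivity
  obtain ⟨v, b, h1, h2, h3, h4, h5, h6, h7⟩ := exists_cluster_perturbation hq ht (by nlinarith)
  -- The last node moves by at most Δ(q + 1)t ≤ Δ < g, so it stays left of the next outer node.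
  have hp : Δ * v q < Δ * q + g := by
    have := mul_le_mul_of_nonneg_left (h4.trans (add_le_add_right htq (q : ℝ))) hΔ.le
    linarith
  refine ⟨spreadSignal d κ (v := v) (b := fun k => γ * b k) hg hΔ hm
    (fun i k hik hk => lt_of_interlacing h1 h2 hik hk)
    (by simpa using (h1 0 (by omega)).le) hp (fun k hk => mul_pos hγ (h5 k hk)), ?_, ?_⟩
  · intro s hs
    rw [PosSignal.fourier_eq_sum, PosSignal.fourier_eq_sum]
    simp only [hFa, hFx, spreadSignal]
    rw [sum_spread_sub hd]
    have hsum : ∀ (c : ℝ) (a w : ℕ → ℝ),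
        ∑ k ∈ range (q + 1), ((γ * a k : ℝ) : ℂ) * Complex.exp ((c * w k : ℝ) * Complex.I) =
        (γ : ℂ) * ∑ k ∈ range (q + 1), (a k : ℂ) * Complex.exp ((c * w k : ℝ) * Complex.I) := by
      intro c a w
      rw [mul_sum]
      refine sum_congr rfl fun k _ => ?_
      push_cast
      ring
    rw [hsum, hsum, ← mul_sub, norm_mul, Complex.norm_real, Real.norm_eq_abs, abs_of_pos hγ]
    refine le_trans (mul_le_mul_of_nonneg_left ((h7 _).trans ?_) hγ.le) hε
    refine mul_le_mul_of_nonneg_left (pow_le_pow_left₀ (abs_nonneg _) ?_ _) (by positivity)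
    have he : -2 * Real.pi * s * Δ = -(2 * Real.pi * Δ * s) := by ring
    have hpos : 0 ≤ 2 * Real.pi * Δ := by positivity
    rw [he, abs_neg, abs_mul, abs_of_nonneg hpos]
    calc _ ≤ 2 * Real.pi * Δ * Ω := mul_le_mul_of_nonneg_left (abs_le.2 ⟨hs.1, hs.2⟩) hpos
      _ = _ := by ring
  · intro j hj
    rw [hFa, hFx]
    simp only [spreadSignal]
    have hn : ∀ v : ℕ → ℝ, spreadNode q κ g Δ v j = Δ * v q := fun v => by
      rw [spreadNode, if_neg (by omega), if_pos (by omega), hj, Nat.add_sub_cancel_left]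
    have ha : ∀ b : ℕ → ℝ, spreadAmp q κ m b j = b q := fun b => by
      rw [spreadAmp, if_pos (by omega), hj, Nat.add_sub_cancel_left]
    rw [hn, hn, ha, ha]
    constructor
    · refine le_trans ?_ (le_abs_self _)
      have := mul_le_mul_of_nonneg_left h3 hΔ.le
      linarith
    · refine le_trans ?_ (neg_le_abs _)
      have := mul_le_mul_of_nonneg_left h6 hγ.le
      linarith

theorem theorem2p7 (d p : ℕ) (m M : ℝ) (hm : 0 < m) (hmM : m ≤ M) (hp : 2 ≤ p) (hpd : p ≤ d) :
    ∃ C₁ C₂ C₃ C₄ C₅ : ℝ, 0 < C₁ ∧ 0 < C₂ ∧ 0 < C₃ ∧ 0 < C₄ ∧ 0 < C₅ ∧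
      ∀ κ : ℕ, κ + p ≤ d →
      ∀ τ η T : ℝ, 0 < τ → τ ≤ 1 / ((p : ℝ) - 1) → 0 < η → η < 1 / (d : ℝ) → 0 < T →
      ∀ Ω h : ℝ, 0 < Ω → 0 < h → h ≤ C₄ * T → Ω * h ≤ C₅ →
      ∃ F : PosSignal d, IsClustered p h T τ η κ F.node ∧ m ≤ ‖F.amp‖ ∧ ‖F.amp‖ ≤ M ∧
      ∃ j₁ ∈ clusterIdx d p κ, ∃ j₂ ∈ clusterIdx d p κ,
      ∀ ε : ℝ, 0 < ε → ε ≤ C₃ * (Ω * τ * h) ^ (2 * (p : ℤ) - 1) →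
        ENNReal.ofReal (C₁ / Ω * ε * (Ω * τ * h) ^ (-2 * (p : ℤ) + 2)) ≤
          Metric.ediam (F.nodeErrorSet ε Ω j₁) ∧
        (∀ j ∉ clusterIdx d p κ,
          ENNReal.ofReal (C₁ / Ω * ε) ≤ Metric.ediam (F.nodeErrorSet ε Ω j)) ∧
        ENNReal.ofReal (C₂ * ε * (Ω * τ * h) ^ (-2 * (p : ℤ) + 1)) ≤
          Metric.ediam (F.ampErrorSet ε Ω j₂) ∧
        (∀ j ∉ clusterIdx d p κ,
          ENNReal.ofReal (C₂ * ε) ≤ Metric.ediam (F.ampErrorSet ε Ω j)) := by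
  obtain ⟨q, rfl⟩ : ∃ q, p = q + 1 := ⟨p - 1, by omega⟩
  have hq : 1 ≤ q := by omega
  have hq' : (1 : ℝ) ≤ q := by exact_mod_cast hq
  have hd' : (1 : ℝ) ≤ d := by exact_mod_cast (by omega : 1 ≤ d)
  have hπ := Real.pi_pos
  obtain ⟨k₀, hk₀, hmax⟩ := exists_max_gridAmp q
  have hA := gridAmp_pos hk₀
  have hB := gridAmp_pos (le_refl q)
  -- The largest cluster amplitude becomes m, the value used outside, so the sup norm is exactly m.
  set γ := m / gridAmp q k₀ with hγ
  have hγ0 : 0 < γ := by positivity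
  set K := 2 * γ * (2 * Real.pi) ^ (2 * q + 1) with hK
  have hK0 : 0 < K := by positivity
  set c := γ * gridAmp q q / (2 * (q + 1) * K) with hc
  have hc0 : 0 < c := by positivity
  -- `K` and `c` come from the cluster; 2πm and 1 come from moving an outer node and raising an
  -- outer amplitude. C₄ = 1/(2d) makes h at most half the spacing T/d, and C₅ = 1 gives Ωτh ≤ 1.
  refine ⟨min (1 / K) (1 / (2 * Real.pi * m)), min 1 c, min (K / (q + 1)) (2 * Real.pi * m),
    1 / (2 * d), 1, by positivity, by positivity, by positivity, by positivity, one_pos, ?_⟩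
  intro κ hκ τ η T hτ hτp hη hηd hT Ω h hΩ hh hhT hΩh
  set g := T / d with hg
  have hg0 : 0 < g := by positivity
  have hgT : g ≤ T := div_le_self hT.le hd'
  have hhg : h ≤ g / 2 := hhT.trans_eq (by rw [hg]; field_simp)
  have hτq : τ * q ≤ 1 := by
    rw [Nat.cast_succ, add_sub_cancel_right, le_div_iff₀ (by positivity)] at hτp
    exact hτp
  have hτ1 : τ ≤ 1 := by nlinarith
  have hη1 : η ≤ 1 := hηd.le.trans (by rw [div_le_one (by positivity)]; exact hd')
  have hηg : η * T ≤ g := by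
    have := mul_le_mul_of_nonneg_right hηd.le hT.le
    rwa [one_div_mul_eq_div] at this
  have hdg : (d : ℝ) * g = T := by rw [hg]; field_simp
  have hΔ : 0 < τ * h := by positivity
  have hΔh : τ * h ≤ h := mul_le_of_le_one_left hh.le hτ1
  have hΔg : τ * h < g := by linarith
  set F : PosSignal d := spreadSignal d (p := q) κ (v := fun k => (k : ℝ))
    (b := fun k => γ * gridAmp q k) hg0 hΔ hm (fun i k hik _ => by exact_mod_cast hik)
    (by simp) (by linarith) (fun k hk => mul_pos hγ0 (gridAmp_pos hk)) with hF
  have hFa : ∀ j, F.amp j = spreadAmp q κ m (fun k => γ * gridAmp q k) j := fun j => rfl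
  have hFx : ∀ j, F.node j = spreadNode q κ g (τ * h) (fun k => (k : ℝ)) j := fun j => rfl
  have hamp : ∀ j, F.amp j ≤ m := fun j => by
    rw [hFa, spreadAmp]
    split_ifs with hj
    · rw [hγ, div_mul_eq_mul_div, div_le_iff₀ hA]
      exact mul_le_mul_of_nonneg_left (hmax _ (by omega)) hm.le
    · exact le_rfl
  have hout : ∀ j ∉ clusterIdx d (q + 1) κ, ¬ (κ ≤ (j : ℕ) ∧ (j : ℕ) ≤ κ + q) :=
    fun j hj e => hj ⟨e.1, by omega⟩
  -- Both j₁ and j₂ are the last cluster index, where the shifts are bounded below.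
  refine ⟨F, isClustered_spreadNode hq hκ hτ hτq hη hη1 hh (by linarith) hηg (by nlinarith),
    ?_, ?_, ⟨κ + q, by omega⟩, ⟨by simp, by simp⟩, ⟨κ + q, by omega⟩, ⟨by simp, by simp⟩, ?_⟩
  · have h1 : F.amp ⟨κ + k₀, by omega⟩ = m := by
      rw [hFa, spreadAmp, if_pos (by simp; omega), Nat.add_sub_cancel_left, hγ,
        div_mul_cancel₀ _ hA.ne']
    calc m = ‖F.amp ⟨κ + k₀, by omega⟩‖ := by rw [h1, Real.norm_of_nonneg hm.le]
      _ ≤ _ := norm_le_pi_norm _ _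
  · refine le_trans ((pi_norm_le_iff_of_nonneg hm.le).2 fun j => ?_) hmM
    rw [Real.norm_of_nonneg (F.amp_pos j).le]
    exact hamp j
  intro ε hε hεC
  set X := Ω * τ * h with hX
  have hX0 : 0 < X := by positivity
  have hX1 : X ≤ τ := by
    have : X = τ * (Ω * h) := by rw [hX]; ring
    rw [this]
    exact mul_le_of_le_one_right hτ.le hΩh
  have e1 : X ^ (2 * ((q + 1 : ℕ) : ℤ) - 1) = X ^ (2 * q + 1) := by
    rw [← zpow_natCast]
    congr 1
    push_cast
    ring
  have e2 : X ^ (-2 * ((q + 1 : ℕ) : ℤ) + 2) = (X ^ (2 * q))⁻¹ := by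
    rw [← zpow_natCast, ← zpow_neg]
    congr 1
    push_cast
    ring
  have e3 : X ^ (-2 * ((q + 1 : ℕ) : ℤ) + 1) = (X ^ (2 * q + 1))⁻¹ := by
    rw [← zpow_natCast, ← zpow_neg]
    congr 1
  rw [e1] at hεC
  rw [e2, e3]
  -- This t makes the bound on the Fourier difference exactly ε; C₃ ≤ K/(q + 1) then gives (q + 1)t
  -- ≤ 1.
  set t := ε / (K * X ^ (2 * q + 1)) with ht
  have ht0 : 0 < t := by positivity
  have htq : ((q : ℝ) + 1) * t ≤ 1 := by
    have h1 : ε ≤ K / (q + 1) * X ^ (2 * q + 1) :=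
      hεC.trans (mul_le_mul_of_nonneg_right (min_le_left _ _) (by positivity))
    rw [ht, mul_div_assoc', div_le_one (by positivity)]
    calc ((q : ℝ) + 1) * ε ≤ (q + 1) * (K / (q + 1) * X ^ (2 * q + 1)) :=
          mul_le_mul_of_nonneg_left h1 (by positivity)
      _ = K * X ^ (2 * q + 1) := by field_simp
  have hεt : γ * (2 * t * (2 * Real.pi * (Ω * (τ * h))) ^ (2 * q + 1)) = ε := by
    have : Ω * (τ * h) = X := by rw [hX]; ring
    rw [this, mul_pow]
    calc _ = t * (K * X ^ (2 * q + 1)) := by rw [hK]; ring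
      _ = ε := by rw [ht]; field_simp
  obtain ⟨G, hG, hGj⟩ := exists_mem_errorSet_spreadSignal hq hκ hg0 hΔ hm hγ0 hΔg hFa hFx ht0 htq
    hεt.le
  refine ⟨?_, ?_, ?_, ?_⟩
  · refine PosSignal.le_ediam_nodeErrorSet hε.le hG _ (le_trans ?_ (hGj _ rfl).1)
    calc _ ≤ 1 / K / Ω * ε * (X ^ (2 * q))⁻¹ := by
          gcongr
          exact min_le_left _ _
      _ = X / Ω * t := by
          rw [ht, pow_succ]
          field_simp
      _ = τ * h * t := by
          rw [hX]
          field_simp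
  · intro j hj
    have hj := hout j hj
    have hpm : 0 < 2 * Real.pi * m := by positivity
    -- Moving an amplitude of at most m by δ changes the transform by at most 2πΩmδ = ε. Moreover C₃
    -- ≤ 2πm and X ≤ 1 give δ ≤ X/Ω = τh < g.
    refine PosSignal.le_ediam_nodeErrorSet_of_gap (δ := ε / (2 * Real.pi * m * Ω)) hε.le
      (by positivity) j (fun k hk => ?_) ?_ ?_
    · have hgap := spreadNode_natCast_gap (p := q) hg0 hΔ (Fin.lt_def.1 hk) (Or.inl hj)
      rw [← hFx, ← hFx] at hgap
      refine lt_of_lt_of_le (add_lt_add_right ?_ _) hgap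
      refine lt_of_le_of_lt ?_ hΔg
      rw [div_le_iff₀ (by positivity)]
      calc ε ≤ 2 * Real.pi * m * X ^ (2 * q + 1) :=
            hεC.trans (mul_le_mul_of_nonneg_right (min_le_right _ _) (by positivity))
        _ ≤ 2 * Real.pi * m * X :=
            mul_le_mul_of_nonneg_left
              (pow_le_of_le_one hX0.le (hX1.trans hτ1) (by omega)) hpm.le
        _ = _ := by rw [hX]; ring
    · calc _ ≤ m * (2 * Real.pi * Ω * (ε / (2 * Real.pi * m * Ω))) := by
            gcongr
            exact hamp j
        _ = ε := by field_simp
        _ ≤ ε := le_rfl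
    · calc _ ≤ 1 / (2 * Real.pi * m) / Ω * ε := by
            gcongr
            exact min_le_right _ _
        _ = _ := by field_simp
        _ ≤ _ := le_rfl
  · refine PosSignal.le_ediam_ampErrorSet hε.le hG _ (le_trans ?_ (hGj _ rfl).2)
    calc _ ≤ c * ε * (X ^ (2 * q + 1))⁻¹ := by
          gcongr
          exact min_le_right _ _
      _ = _ := by
          rw [hc, ht]
          field_simp
  · intro j _
    exact PosSignal.le_ediam_ampErrorSet_of_le hε.le Ω j
      (mul_le_of_le_one_left hε.le (min_le_left _ _))

end
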